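/- Let $\alpha,\beta\in\mathbb{R}$. The generalized bicomplex numbers are the commutative real algebra $C_{\alpha\beta}$ with basis $1,i,j,ij$ and $i^2=-\alpha$, $j^2=-\beta$, $ij=ji$; we write $x=x_1 1+x_2 i+x_3 j+x_4 ij=(x_1,x_2,x_3,x_4)\in\mathbb{R}^4$. Let $g_{t_i}(x,x)=x_1^2+\alpha x_2^2-\beta x_3^2-\alpha\beta x_4^2$ and $$M_{t_i}=\{x\in C_{\alpha\beta} : x_1x_3+\alpha x_2x_4=0,\ g_{t_i}(x,x)\neq 0\},$$ a three-dimensional Lie group under the product of $C_{\alpha\beta}$, smoothly embedded in $\mathbb{R}^4$. Then the Lie algebra of $M_{t_i}$ is $\mathrm{sp}\{X_1,X_2,X_4\}$, in the following sense. The tangent space of $M_{t_i}$ at the identity, regarded as a subspace of $\mathbb{R}^4=C_{\alpha\beta}$, is spanned by $1,i,ij$ (so the $j$-component of every tangent vector at the identity vanishes). The left-invariant vector fields $X_1,X_2,X_4$ whose values at the identity are $1,i,ij$ are given at $x\in M_{t_i}$ by $$X_1=x=(x_1,x_2,x_3,x_4),\qquad X_2=x\cdot i=(-\alpha x_2,x_1,-\alpha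 x_4,x_3),\qquad X_4=x\cdot ij=(\alpha\beta x_4,-\beta x_3,-\alpha x_2,x_1),$$ they are linearly independent, and the space of all smooth left-invariant vector fields on $M_{t_i}$ is their real span. -/

import Mathlib

open scoped Manifold ContDiff

noncomputable section

/-- The generalized bicomplex numbers `x = x₁ 1 + x₂ i + x₃ j + x₄ ij`, where `i² = -α`, `j² = -β`,
`ij = ji`. As a normed space this is `ℝ⁴`; the product is given below. -/
def GenBicomplex (_α _β : ℝ) : Type := EuclideanSpace ℝ (Fin 4)

namespace GenBicomplex

instance instNormedAddCommGroup (α β : ℝ) : NormedAddCommGroup (GenBicomplex α β) :=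
  inferInstanceAs (NormedAddCommGroup (EuclideanSpace ℝ (Fin 4)))

instance instNormedSpace (α β : ℝ) : NormedSpace ℝ (GenBicomplex α β) :=
  inferInstanceAs (NormedSpace ℝ (EuclideanSpace ℝ (Fin 4)))

instance instFiniteDimensional (α β : ℝ) : FiniteDimensional ℝ (GenBicomplex α β) :=
  inferInstanceAs (FiniteDimensional ℝ (EuclideanSpace ℝ (Fin 4)))

/-- The coordinates `x₁, x₂, x₃, x₄` of a generalized bicomplex number, indexed by `0, 1, 2, 3`. -/
def coord {α β : ℝ} (k : Fin 4) : GenBicomplex α β →L[ℝ] ℝ :=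
  (EuclideanSpace.proj k : EuclideanSpace ℝ (Fin 4) →L[ℝ] ℝ)

/-- The coefficient `x₁` of `1`. -/
def re {α β : ℝ} (x : GenBicomplex α β) : ℝ := coord 0 x
/-- The coefficient `x₂` of `i`. -/
def imI {α β : ℝ} (x : GenBicomplex α β) : ℝ := coord 1 x
/-- The coefficient `x₃` of `j`. -/
def imJ {α β : ℝ} (x : GenBicomplex α β) : ℝ := coord 2 x
/-- The coefficient `x₄` of `ij`. -/
def imIJ {α β : ℝ} (x : GenBicomplex α β) : ℝ := coord 3 x

/-- The generalized bicomplex number `a 1 + b i + c j + d ij`. -/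
def mk {α β : ℝ} (a b c d : ℝ) : GenBicomplex α β := (!₂[a, b, c, d] : EuclideanSpace ℝ (Fin 4))

variable {α β : ℝ}

@[simp] lemma re_mk (a b c d : ℝ) : (mk a b c d : GenBicomplex α β).re = a := rfl
@[simp] lemma imI_mk (a b c d : ℝ) : (mk a b c d : GenBicomplex α β).imI = b := rfl
@[simp] lemma imJ_mk (a b c d : ℝ) : (mk a b c d : GenBicomplex α β).imJ = c := rfl
@[simp] lemma imIJ_mk (a b c d : ℝ) : (mk a b c d : GenBicomplex α β).imIJ = d := rfl

@[ext] lemma ext {x y : GenBicomplex α β} (h₁ : x.re = y.re) (h₂ : x.imI = y.imI)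
    (h₃ : x.imJ = y.imJ) (h₄ : x.imIJ = y.imIJ) : x = y := by
  have : ∀ k : Fin 4, coord k x = coord k y := by
    intro k
    fin_cases k
    exacts [h₁, h₂, h₃, h₄]
  exact PiLp.ext this

@[simp] lemma re_add (x y : GenBicomplex α β) : (x + y).re = x.re + y.re := rfl
@[simp] lemma imI_add (x y : GenBicomplex α β) : (x + y).imI = x.imI + y.imI := rfl
@[simp] lemma imJ_add (x y : GenBicomplex α β) : (x + y).imJ = x.imJ + y.imJ := rfl
@[simp] lemma imIJ_add (x y : GenBicomplex α β) : (x + y).imIJ = x.imIJ + y.imIJ := rfl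
@[simp] lemma re_zero : (0 : GenBicomplex α β).re = 0 := rfl
@[simp] lemma imI_zero : (0 : GenBicomplex α β).imI = 0 := rfl
@[simp] lemma imJ_zero : (0 : GenBicomplex α β).imJ = 0 := rfl
@[simp] lemma imIJ_zero : (0 : GenBicomplex α β).imIJ = 0 := rfl
@[simp] lemma re_smul (c : ℝ) (x : GenBicomplex α β) : (c • x).re = c * x.re := rfl
@[simp] lemma imI_smul (c : ℝ) (x : GenBicomplex α β) : (c • x).imI = c * x.imI := rfl
@[simp] lemma imJ_smul (c : ℝ) (x : GenBicomplex α β) : (c • x).imJ = c * x.imJ := rfl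
@[simp] lemma imIJ_smul (c : ℝ) (x : GenBicomplex α β) : (c • x).imIJ = c * x.imIJ := rfl

/-- The generalized bicomplex product. -/
instance instMul : Mul (GenBicomplex α β) where
  mul x y := mk
    (x.re * y.re - α * (x.imI * y.imI) - β * (x.imJ * y.imJ) + α * β * (x.imIJ * y.imIJ))
    (x.re * y.imI + x.imI * y.re - β * (x.imJ * y.imIJ) - β * (x.imIJ * y.imJ))
    (x.re * y.imJ + x.imJ * y.re - α * (x.imI * y.imIJ) - α * (x.imIJ * y.imI))
    (x.re * y.imIJ + x.imIJ * y.re + x.imI * y.imJ + x.imJ * y.imI)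

instance instOne : One (GenBicomplex α β) where
  one := mk 1 0 0 0

@[simp] lemma re_one : (1 : GenBicomplex α β).re = 1 := rfl
@[simp] lemma imI_one : (1 : GenBicomplex α β).imI = 0 := rfl
@[simp] lemma imJ_one : (1 : GenBicomplex α β).imJ = 0 := rfl
@[simp] lemma imIJ_one : (1 : GenBicomplex α β).imIJ = 0 := rfl
@[simp] lemma re_mul (x y : GenBicomplex α β) : (x * y).re =
    x.re * y.re - α * (x.imI * y.imI) - β * (x.imJ * y.imJ) + α * β * (x.imIJ * y.imIJ) := rfl
@[simp] lemma imI_mul (x y : GenBicomplex α β) : (x * y).imI =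
    x.re * y.imI + x.imI * y.re - β * (x.imJ * y.imIJ) - β * (x.imIJ * y.imJ) := rfl
@[simp] lemma imJ_mul (x y : GenBicomplex α β) : (x * y).imJ =
    x.re * y.imJ + x.imJ * y.re - α * (x.imI * y.imIJ) - α * (x.imIJ * y.imI) := rfl
@[simp] lemma imIJ_mul (x y : GenBicomplex α β) : (x * y).imIJ =
    x.re * y.imIJ + x.imIJ * y.re + x.imI * y.imJ + x.imJ * y.imI := rfl

instance instCommRing : CommRing (GenBicomplex α β) where
  __ := (instNormedAddCommGroup α β).toAddCommGroup
  mul_assoc x y z := by ext <;> simp <;> ring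
  one_mul x := by ext <;> simp
  mul_one x := by ext <;> simp
  left_distrib x y z := by ext <;> simp <;> ring
  right_distrib x y z := by ext <;> simp <;> ring
  zero_mul x := by ext <;> simp
  mul_zero x := by ext <;> simp
  mul_comm x y := by ext <;> simp <;> ring

instance instAlgebra : Algebra ℝ (GenBicomplex α β) :=
  Algebra.ofModule (fun c x y => by ext <;> simp <;> ring) (fun c x y => by ext <;> simp <;> ring)

/-- The basis element `i`. -/
def i : GenBicomplex α β := mk 0 1 0 0
/-- The basis element `j`. -/
def j : GenBicomplex α β := mk 0 0 1 0

/-- The conjugation `x^{t_i}` with respect to `i`. -/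
def conjI (x : GenBicomplex α β) : GenBicomplex α β := mk x.re (-x.imI) x.imJ (-x.imIJ)

/-- The symmetric bilinear form `g_{t_i} = dx₁² + α dx₂² - β dx₃² - αβ dx₄²`. -/
def gI (x y : GenBicomplex α β) : ℝ :=
  x.re * y.re + α * (x.imI * y.imI) - β * (x.imJ * y.imJ) - α * β * (x.imIJ * y.imIJ)

lemma contDiff_coord (k : Fin 4) : ContDiff ℝ ∞ (coord k : GenBicomplex α β → ℝ) :=
  (coord k : GenBicomplex α β →L[ℝ] ℝ).contDiff
@[fun_prop] lemma contDiff_re : ContDiff ℝ ∞ (re : GenBicomplex α β → ℝ) := contDiff_coord 0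
@[fun_prop] lemma contDiff_imI : ContDiff ℝ ∞ (imI : GenBicomplex α β → ℝ) := contDiff_coord 1
@[fun_prop] lemma contDiff_imJ : ContDiff ℝ ∞ (imJ : GenBicomplex α β → ℝ) := contDiff_coord 2
@[fun_prop] lemma contDiff_imIJ : ContDiff ℝ ∞ (imIJ : GenBicomplex α β → ℝ) := contDiff_coord 3

lemma contDiff_mk : ContDiff ℝ ∞
    (fun u : Fin 4 → ℝ => (mk (u 0) (u 1) (u 2) (u 3) : GenBicomplex α β)) := by
  have : (fun u : Fin 4 → ℝ => (mk (u 0) (u 1) (u 2) (u 3) : GenBicomplex α β)) =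
      (EuclideanSpace.equiv (Fin 4) ℝ).symm := by
    funext u
    refine PiLp.ext fun k => ?_
    fin_cases k <;> rfl
  rw [this]
  exact (EuclideanSpace.equiv (Fin 4) ℝ).symm.contDiff

lemma contDiff_mk_comp {E : Type*} [NormedAddCommGroup E] [NormedSpace ℝ E] {s : Set E}
    {a b c d : E → ℝ} (ha : ContDiffOn ℝ ∞ a s) (hb : ContDiffOn ℝ ∞ b s)
    (hc : ContDiffOn ℝ ∞ c s) (hd : ContDiffOn ℝ ∞ d s) :
    ContDiffOn ℝ ∞ (fun u => (mk (a u) (b u) (c u) (d u) : GenBicomplex α β)) s := by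
  have h : ContDiffOn ℝ ∞ (fun u => ![a u, b u, c u, d u]) s := by
    rw [contDiffOn_pi]
    intro k
    fin_cases k
    exacts [ha, hb, hc, hd]
  exact contDiff_mk.comp_contDiffOn h

lemma contDiff_mul : ContDiff ℝ ∞
    (fun p : GenBicomplex α β × GenBicomplex α β => p.1 * p.2) := by
  rw [← contDiffOn_univ]
  apply contDiff_mk_comp <;> rw [contDiffOn_univ] <;> fun_prop

instance instContinuousMul (α β : ℝ) : ContinuousMul (GenBicomplex α β) where
  continuous_mul := contDiff_mul.continuous

@[fun_prop] lemma contDiff_gI : ContDiff ℝ ∞ (fun x : GenBicomplex α β => gI x x) := by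
  unfold gI
  fun_prop

lemma contDiff_conjI : ContDiff ℝ ∞ (conjI : GenBicomplex α β → GenBicomplex α β) := by
  rw [← contDiffOn_univ]
  apply contDiff_mk_comp <;> rw [contDiffOn_univ] <;> fun_prop

end GenBicomplex

open GenBicomplex

/-- The set `M_{t_i} = {x : x₁ x₃ + α x₂ x₄ = 0, g_{t_i}(x, x) ≠ 0}`, with the topology induced
from `ℝ⁴`. -/
@[ext] structure MtI (α β : ℝ) where
  /-- The inclusion of `M_{t_i}` in the generalized bicomplex numbers. -/
  incl : GenBicomplex α β
  quad : incl.re * incl.imJ + α * (incl.imI * incl.imIJ) = 0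
  gI_ne_zero : gI incl incl ≠ 0

namespace MtI

variable {α β : ℝ}

instance instTopologicalSpace (α β : ℝ) : TopologicalSpace (MtI α β) :=
  TopologicalSpace.induced incl inferInstance

lemma isEmbedding_incl : Topology.IsEmbedding (incl : MtI α β → GenBicomplex α β) :=
  ⟨⟨rfl⟩, fun _ _ h => MtI.ext h⟩

lemma quad_mul (x y : GenBicomplex α β) :
    (x * y).re * (x * y).imJ + α * ((x * y).imI * (x * y).imIJ) =
      (x.re * x.imJ + α * (x.imI * x.imIJ)) * gI y y +
        gI x x * (y.re * y.imJ + α * (y.imI * y.imIJ)) := by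
  simp only [gI, re_mul, imI_mul, imJ_mul, imIJ_mul]
  ring

lemma gI_mul (x y : GenBicomplex α β) : gI (x * y) (x * y) = gI x x * gI y y - 4 * β *
    (x.re * x.imJ + α * (x.imI * x.imIJ)) * (y.re * y.imJ + α * (y.imI * y.imIJ)) := by
  simp only [gI, re_mul, imI_mul, imJ_mul, imIJ_mul]
  ring

lemma gI_smul_conjI (c : ℝ) (x : GenBicomplex α β) :
    gI (c • conjI x) (c • conjI x) = c ^ 2 * gI x x := by
  simp only [gI, re_smul, imI_smul, imJ_smul, imIJ_smul, conjI, re_mk, imI_mk, imJ_mk, imIJ_mk]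
  ring

/-- The group structure on `M_{t_i}` given by the generalized bicomplex product; the inverse of `x`
is `x^{t_i} / g_{t_i}(x, x)`. -/
instance instCommGroup (α β : ℝ) : CommGroup (MtI α β) where
  mul x y := ⟨x.incl * y.incl, by
    rw [quad_mul, x.quad, y.quad]
    simp, by
    rw [gI_mul, x.quad, y.quad]
    simpa using ⟨x.gI_ne_zero, y.gI_ne_zero⟩⟩
  one := ⟨1, by simp, by simp [gI]⟩
  inv x := ⟨(gI x.incl x.incl)⁻¹ • conjI x.incl, by
    have hx := x.quad
    simp only [re_smul, imI_smul, imJ_smul, imIJ_smul, conjI, re_mk, imI_mk, imJ_mk, imIJ_mk]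
    linear_combination (gI x.incl x.incl)⁻¹ ^ 2 * hx, by
    rw [gI_smul_conjI]
    exact mul_ne_zero (pow_ne_zero _ (inv_ne_zero x.gI_ne_zero)) x.gI_ne_zero⟩
  mul_assoc x y z := MtI.ext (mul_assoc x.incl y.incl z.incl)
  one_mul x := MtI.ext (one_mul x.incl)
  mul_one x := MtI.ext (mul_one x.incl)
  mul_comm x y := MtI.ext (mul_comm x.incl y.incl)
  inv_mul_cancel x := by
    obtain ⟨x, hx, hx'⟩ := x
    refine MtI.ext ?_
    change ((gI x x)⁻¹ • conjI x) * x = 1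
    rw [smul_mul_assoc, inv_smul_eq_iff₀ hx']
    ext <;> simp only [conjI, gI, re_mul, imI_mul, imJ_mul, imIJ_mul, re_smul, imI_smul, imJ_smul,
      imIJ_smul, re_mk, imI_mk, imJ_mk, imIJ_mk, re_one, imI_one, imJ_one, imIJ_one]
    · ring
    · ring
    · linear_combination 2 * hx
    · ring

@[simp] lemma incl_mul (x y : MtI α β) : (x * y).incl = x.incl * y.incl := rfl
@[simp] lemma incl_one : (1 : MtI α β).incl = 1 := rfl

instance instContinuousMul (α β : ℝ) : ContinuousMul (MtI α β) where
  continuous_mul := by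
    rw [isEmbedding_incl.continuous_iff]
    exact (isEmbedding_incl.continuous.comp continuous_fst).mul
      (isEmbedding_incl.continuous.comp continuous_snd)

/-- The coordinates `(x₁, x₂, x₄)`. -/
def proj : GenBicomplex α β →L[ℝ] EuclideanSpace ℝ (Fin 3) :=
  ((EuclideanSpace.equiv (Fin 3) ℝ).symm : (Fin 3 → ℝ) →L[ℝ] EuclideanSpace ℝ (Fin 3)).comp
    (ContinuousLinearMap.pi ![coord 0, coord 1, coord 3])

@[simp] lemma proj_zero (x : GenBicomplex α β) : proj x 0 = x.re := rfl
@[simp] lemma proj_one (x : GenBicomplex α β) : proj x 1 = x.imI := rfl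
@[simp] lemma proj_two (x : GenBicomplex α β) : proj x 2 = x.imIJ := rfl

variable (α β) in
/-- The parametrization `(a, b, c) ↦ (a, b, - α b c / a, c)` of the part of `M_{t_i}` where
`x₁ ≠ 0`. -/
def param (u : EuclideanSpace ℝ (Fin 3)) : GenBicomplex α β :=
  GenBicomplex.mk (u 0) (u 1) (-(α * (u 1 * u 2)) / u 0) (u 2)

lemma proj_param (u : EuclideanSpace ℝ (Fin 3)) : proj (param α β u) = u := by
  refine PiLp.ext fun k => ?_
  fin_cases k <;> rfl

lemma contDiffOn_param : ContDiffOn ℝ ∞ (param α β) {u | u 0 ≠ 0} := by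
  apply contDiff_mk_comp
  · fun_prop
  · fun_prop
  · exact ContDiffOn.div (by fun_prop) (by fun_prop) (fun u hu => hu)
  · fun_prop

lemma isOpen_ne : IsOpen {u : EuclideanSpace ℝ (Fin 3) | u 0 ≠ 0} :=
  isOpen_ne_fun (by fun_prop) continuous_const

lemma param_mem (u : EuclideanSpace ℝ (Fin 3)) (hu : u 0 ≠ 0) :
    (param α β u).re * (param α β u).imJ + α * ((param α β u).imI * (param α β u).imIJ) = 0 := by
  simp only [param, re_mk, imI_mk, imJ_mk, imIJ_mk]
  field_simp
  ring

/-- The parametrization with values in `M_{t_i}`, with junk value `1` outside its domain. -/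
def paramM (u : EuclideanSpace ℝ (Fin 3)) : MtI α β :=
  open Classical in
  if h : u 0 ≠ 0 ∧ gI (param α β u) (param α β u) ≠ 0 then { incl := param α β u, quad := param_mem u h.1, gI_ne_zero := h.2 }
  else 1

lemma incl_paramM {u : EuclideanSpace ℝ (Fin 3)}
    (h : u 0 ≠ 0 ∧ gI (param α β u) (param α β u) ≠ 0) :
    (paramM u : MtI α β).incl = param α β u := by
  rw [paramM, dif_pos h]

lemma param_proj (x : MtI α β) (hx : x.incl.re ≠ 0) : param α β (proj x.incl) = x.incl := by
  have := x.quad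
  ext <;> simp only [param, re_mk, imI_mk, imJ_mk, imIJ_mk, proj_zero, proj_one, proj_two]
  field_simp
  linear_combination -this

/-- The chart `x ↦ (x₁, x₂, x₄)` on the part of `M_{t_i}` where `x₁ ≠ 0`. -/
def chartOne (α β : ℝ) : OpenPartialHomeomorph (MtI α β) (EuclideanSpace ℝ (Fin 3)) where
  toFun x := proj x.incl
  invFun := paramM
  source := {x | x.incl.re ≠ 0}
  target := {u | u 0 ≠ 0 ∧ gI (param α β u) (param α β u) ≠ 0}
  map_source' x hx := by
    refine ⟨hx, ?_⟩
    rw [param_proj x hx]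
    exact x.gI_ne_zero
  map_target' u hu := by
    change (paramM u : MtI α β).incl.re ≠ 0
    rw [incl_paramM hu]
    exact hu.1
  left_inv' x hx := by
    have h : proj x.incl 0 ≠ 0 ∧ gI (param α β (proj x.incl)) (param α β (proj x.incl)) ≠ 0 := by
      refine ⟨hx, ?_⟩
      rw [param_proj x hx]
      exact x.gI_ne_zero
    ext1
    rw [incl_paramM h, param_proj x hx]
  right_inv' u hu := by rw [incl_paramM hu, proj_param]
  open_source := isOpen_ne_fun (contDiff_re.continuous.comp isEmbedding_incl.continuous)
    continuous_const
  open_target :=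
    (contDiff_gI.continuous.comp_continuousOn contDiffOn_param.continuousOn).isOpen_inter_preimage
      isOpen_ne (t := {r : ℝ | r ≠ 0}) isOpen_compl_singleton
  continuousOn_toFun := (proj.continuous.comp isEmbedding_incl.continuous).continuousOn
  continuousOn_invFun := by
    rw [isEmbedding_incl.continuousOn_iff]
    refine (contDiffOn_param.continuousOn.mono fun u hu => hu.1).congr fun u hu => ?_
    exact incl_paramM hu

/-- The chart at `x`: left translation by `x⁻¹` followed by the chart at the identity. -/
def chart (x : MtI α β) : OpenPartialHomeomorph (MtI α β) (EuclideanSpace ℝ (Fin 3)) :=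
  (Homeomorph.mulLeft x⁻¹).transOpenPartialHomeomorph (chartOne α β)

lemma incl_chart_symm (x : MtI α β) {u : EuclideanSpace ℝ (Fin 3)} (hu : u ∈ (chart x).target) :
    ((chart x).symm u).incl = x.incl * param α β u := by
  rw [← incl_paramM (α := α) (β := β) (u := u) hu]
  change (((x⁻¹)⁻¹ * paramM u : MtI α β)).incl = _
  rw [inv_inv, incl_mul]

lemma contDiffOn_incl_chart_symm (x : MtI α β) :
    ContDiffOn ℝ ∞ (fun u => ((chart x).symm u).incl) (chart x).target := by
  refine ContDiffOn.congr ?_ fun u hu => incl_chart_symm x hu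
  exact contDiff_mul.comp_contDiffOn
    (contDiffOn_const.prodMk (contDiffOn_param.mono fun u hu => hu.1))

instance instChartedSpace (α β : ℝ) : ChartedSpace (EuclideanSpace ℝ (Fin 3)) (MtI α β) where
  atlas := Set.range chart
  chartAt := chart
  mem_chart_source x := by
    change (x⁻¹ * x).incl.re ≠ 0
    simp
  chart_mem_atlas x := ⟨x, rfl⟩

lemma contDiff_proj_mul (x : GenBicomplex α β) :
    ContDiff ℝ ∞ (fun y : GenBicomplex α β => proj (x * y)) :=
  proj.contDiff.comp (contDiff_mul.comp (contDiff_const.prodMk contDiff_id))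

instance instIsManifold (α β : ℝ) : IsManifold 𝓘(ℝ, EuclideanSpace ℝ (Fin 3)) ∞ (MtI α β) := by
  apply isManifold_of_contDiffOn
  rintro _ _ ⟨x, rfl⟩ ⟨y, rfl⟩
  exact ((contDiff_proj_mul _).comp_contDiffOn (contDiffOn_incl_chart_symm x)).mono
    fun u hu => hu.1.1

lemma contMDiff_incl : ContMDiff 𝓘(ℝ, EuclideanSpace ℝ (Fin 3)) 𝓘(ℝ, GenBicomplex α β) ∞
    (incl : MtI α β → GenBicomplex α β) := by
  intro x
  rw [contMDiffAt_iff]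
  refine ⟨isEmbedding_incl.continuous.continuousAt, ?_⟩
  have h := (contDiffOn_incl_chart_symm x).contDiffAt
    ((chart x).open_target.mem_nhds ((chart x).map_source (mem_chart_source _ x)))
  exact h.contDiffWithinAt

lemma contMDiff_of_incl {E H N : Type*} [NormedAddCommGroup E] [NormedSpace ℝ E]
    [TopologicalSpace H] {I : ModelWithCorners ℝ E H} [TopologicalSpace N] [ChartedSpace H N]
    {f : N → MtI α β} (hf : ContMDiff I 𝓘(ℝ, GenBicomplex α β) ∞ fun p => (f p).incl) :
    ContMDiff I 𝓘(ℝ, EuclideanSpace ℝ (Fin 3)) ∞ f := by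
  intro p
  rw [contMDiffAt_iff_target]
  refine ⟨(isEmbedding_incl.continuous_iff.2 hf.continuous).continuousAt, ?_⟩
  exact ((contDiff_proj_mul ((f p)⁻¹).incl).contMDiff.comp hf) p

/-- `M_{t_i}` is a three-dimensional real Lie group. -/
instance instLieGroup (α β : ℝ) : LieGroup 𝓘(ℝ, EuclideanSpace ℝ (Fin 3)) ∞ (MtI α β) where
  contMDiff_mul := by
    apply contMDiff_of_incl
    exact contDiff_mul.contMDiff.comp
      ((contMDiff_incl.comp contMDiff_fst).prodMk_space (contMDiff_incl.comp contMDiff_snd))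
  contMDiff_inv := by
    apply contMDiff_of_incl
    intro x
    have h : ContDiffAt ℝ ∞ (fun y : GenBicomplex α β => (gI y y)⁻¹ • conjI y) x.incl :=
      (contDiff_gI.contDiffAt.inv x.gI_ne_zero).smul contDiff_conjI.contDiffAt
    exact h.contMDiffAt.comp x (contMDiff_incl x)

instance instLieGroupMinSmoothness (α β : ℝ) :
    LieGroup 𝓘(ℝ, EuclideanSpace ℝ (Fin 3)) (minSmoothness ℝ 3) (MtI α β) := by
  rw [minSmoothness_of_isRCLikeNormedField]
  infer_instance

end MtI

/-- The left-invariant vector fields on a real Lie group `G`: the smooth sections `V` of the tangent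
bundle with `d(L_g)_h V(h) = V(g h)` for all `g, h`, as a linear subspace of the space of all
sections. -/
def leftInvariantVectorFields {E H : Type*} [NormedAddCommGroup E] [NormedSpace ℝ E]
    [TopologicalSpace H] (I : ModelWithCorners ℝ E H) (G : Type*) [TopologicalSpace G]
    [ChartedSpace H G] [Group G] [LieGroup I ∞ G] :
    Submodule ℝ ((g : G) → TangentSpace I g) where
  carrier := {V | ContMDiff I I.tangent ∞ (fun g => (⟨g, V g⟩ : TangentBundle I G)) ∧
    ∀ g h : G, mfderiv I I (fun y : G => g * y) h (V h) = V (g * h)}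
  add_mem' := fun {V W} hV hW => by
    refine ⟨hV.1.add_section hW.1, fun g h => ?_⟩
    exact (map_add (mfderiv I I (fun y : G => g * y) h) (V h) (W h)).trans
      (congrArg₂ (· + ·) (hV.2 g h) (hW.2 g h))
  zero_mem' := ⟨Bundle.contMDiff_zeroSection ℝ (TangentSpace I : G → Type _),
    fun g h => map_zero (mfderiv I I (fun y : G => g * y) h)⟩
  smul_mem' := fun c V hV => by
    refine ⟨hV.1.const_smul_section, fun g h => ?_⟩
    exact (map_smul (mfderiv I I (fun y : G => g * y) h) c (V h)).trans
      (congrArg (c • ·) (hV.2 g h))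

namespace MtI

/-- The differential at `x` of the inclusion of `M_{t_i}` in the generalized bicomplex numbers: it
sends a tangent vector of `M_{t_i}` to its components `(v₁, v₂, v₃, v₄)` in `ℝ⁴`. -/
def components {α β : ℝ} (x : MtI α β) :
    TangentSpace 𝓘(ℝ, EuclideanSpace ℝ (Fin 3)) x →L[ℝ] GenBicomplex α β :=
  mfderiv 𝓘(ℝ, EuclideanSpace ℝ (Fin 3)) 𝓘(ℝ, GenBicomplex α β) incl x

end MtI

end

noncomputable section

open GenBicomplex

namespace MtI

variable {α β : ℝ}

/-! Where `x₁ ≠ 0`, `M_{t_i}` is the graph `x₃ = -α x₂ x₄ / x₁`. The right-hand side is of second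
order in `(x₂, x₄)`, so its differential vanishes at the identity and the tangent space there is the
hyperplane `x₃ = 0`, spanned by `1, i, ij` (`components_one`, `range_components_one`). The graph is
flattened by a shear, and left translation carries this flattening to every point, so the inclusion
is a smooth embedding (`isSmoothEmbedding_incl`).

Left translation on `M_{t_i}` is the restriction of a linear map of the algebra, hence the
left-invariant extension of a tangent vector `v` is `x ↦ x · v` in components
(`components_mulInvariantVectorField`). On any Lie group, evaluation at the identity identifies
left-invariant fields with tangent vectors there (`leftInvariantVectorFields_eq_range`). What
remains is linear algebra with `1, i, ij`. -/

lemma incl_inv_mul_incl (x : MtI α β) : (x⁻¹).incl * x.incl = 1 :=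
  congrArg incl (inv_mul_cancel x)

lemma incl_mul_incl_inv (x : MtI α β) : x.incl * (x⁻¹).incl = 1 :=
  congrArg incl (mul_inv_cancel x)

/-! ### Slice charts and the smooth embedding. -/

/-- Left multiplication by `x⁻¹`, as a homeomorphism of the generalized bicomplex numbers. -/
def mulLeftInvHomeomorph (x : MtI α β) : GenBicomplex α β ≃ₜ GenBicomplex α β where
  toFun y := (x⁻¹).incl * y
  invFun y := x.incl * y
  left_inv y := by simp only [← mul_assoc, incl_mul_incl_inv, one_mul]
  right_inv y := by simp only [← mul_assoc, incl_inv_mul_incl, one_mul]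
  continuous_toFun := continuous_const.mul continuous_id
  continuous_invFun := continuous_const.mul continuous_id

variable (α β) in
/-- The map adding `c x₂ x₄ / x₁` to the third coordinate. -/
def shear (c : ℝ) (x : GenBicomplex α β) : GenBicomplex α β :=
  GenBicomplex.mk x.re x.imI (x.imJ + c * (x.imI * x.imIJ) / x.re) x.imIJ

/-- The correction term involves only the coordinates that a shear fixes. At `x₁ = 0` the quotient
is `0` by convention, so no condition on `x` is needed. -/
lemma shear_shear (c d : ℝ) (h : c + d = 0) (x : GenBicomplex α β) :
    shear α β c (shear α β d x) = x := by
  obtain rfl : d = -c := by linarith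
  ext <;> simp only [shear, re_mk, imI_mk, imJ_mk, imIJ_mk]
  ring

lemma contDiffOn_shear (c : ℝ) : ContDiffOn ℝ ∞ (shear α β c) {x | x.re ≠ 0} := by
  apply contDiff_mk_comp
  · fun_prop
  · fun_prop
  · exact ContDiffOn.add (by fun_prop) (ContDiffOn.div (by fun_prop) (by fun_prop) fun x hx => hx)
  · fun_prop

lemma isOpen_re_ne : IsOpen {x : GenBicomplex α β | x.re ≠ 0} :=
  isOpen_ne_fun contDiff_re.continuous continuous_const

variable (α β) in
/-- The shear `x ↦ (x₁, x₂, x₃ + α x₂ x₄ / x₁, x₄)`, which maps the part of `M_{t_i}` where `x₁ ≠ 0`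
to the hyperplane `x₃ = 0`. -/
def straighten : OpenPartialHomeomorph (GenBicomplex α β) (GenBicomplex α β) where
  toFun := shear α β α
  invFun := shear α β (-α)
  source := {x | x.re ≠ 0}
  target := {x | x.re ≠ 0}
  map_source' _ hx := hx
  map_target' _ hx := hx
  left_inv' x _ := shear_shear _ _ (by ring) x
  right_inv' x _ := shear_shear _ _ (by ring) x
  open_source := isOpen_re_ne
  open_target := isOpen_re_ne
  continuousOn_toFun := (contDiffOn_shear α).continuousOn
  continuousOn_invFun := (contDiffOn_shear (-α)).continuousOn

/-- A chart of the generalized bicomplex numbers at `x` that maps `M_{t_i}` to the hyperplane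
`x₃ = 0`. -/
def sliceChart (x : MtI α β) : OpenPartialHomeomorph (GenBicomplex α β) (GenBicomplex α β) :=
  x.mulLeftInvHomeomorph.transOpenPartialHomeomorph (straighten α β)

lemma sliceChart_mem_maximalAtlas (x : MtI α β) :
    sliceChart x ∈ IsManifold.maximalAtlas 𝓘(ℝ, GenBicomplex α β) ∞ (GenBicomplex α β) := by
  apply OpenPartialHomeomorph.mem_maximalAtlas_of_contMDiffOn
  · rw [contMDiffOn_iff_contDiffOn]
    exact (contDiffOn_shear α).comp
      (contDiff_mul.comp (contDiff_const.prodMk contDiff_id)).contDiffOn fun y hy => hy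
  · rw [contMDiffOn_iff_contDiffOn]
    exact (contDiff_mul.comp (contDiff_const.prodMk contDiff_id)).comp_contDiffOn
      (contDiffOn_shear (-α))

variable (α β) in
/-- The linear isomorphism `((a, b, c), t) ↦ (a, b, t, c)`. -/
def sliceEquiv : (EuclideanSpace ℝ (Fin 3) × ℝ) ≃L[ℝ] GenBicomplex α β :=
  LinearEquiv.toContinuousLinearEquiv
    { toFun := fun p => GenBicomplex.mk (p.1 0) (p.1 1) p.2 (p.1 2)
      invFun := fun x => (proj x, x.imJ)
      map_add' := fun _ _ => by ext <;> simp
      map_smul' := fun _ _ => by ext <;> simp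
      left_inv := fun p => by
        refine Prod.ext (PiLp.ext fun k => ?_) rfl
        fin_cases k <;> rfl
      right_inv := fun _ => by ext <;> rfl }

lemma sliceEquiv_apply (p : EuclideanSpace ℝ (Fin 3) × ℝ) :
    sliceEquiv α β p = GenBicomplex.mk (p.1 0) (p.1 1) p.2 (p.1 2) := rfl

/-- In the charts at `x` the inclusion reads `u ↦ (u, 0)`: the two translations by `x` and `x⁻¹`
cancel, and the shear cancels the third coordinate `-α b c / a` of `param`. -/
lemma isSmoothEmbedding_incl :
    Manifold.IsSmoothEmbedding 𝓘(ℝ, EuclideanSpace ℝ (Fin 3)) 𝓘(ℝ, GenBicomplex α β) ∞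
      (incl : MtI α β → GenBicomplex α β) := by
  refine ⟨Manifold.IsImmersionOfComplement.isImmersion (F := ℝ) fun x => ?_, isEmbedding_incl⟩
  refine Manifold.IsImmersionAtOfComplement.mk_of_continuousAt
    isEmbedding_incl.continuous.continuousAt (sliceEquiv α β) (chart x) (sliceChart x)
    (mem_chart_source _ x) ?_ (IsManifold.chart_mem_maximalAtlas x)
    (sliceChart_mem_maximalAtlas x) ?_
  · exact mem_chart_source (EuclideanSpace ℝ (Fin 3)) x
  · intro u hu
    replace hu : u ∈ (chart x).target := by simpa using hu
    change shear α β α ((x⁻¹).incl * ((chart x).symm u).incl) = sliceEquiv α β (u, 0)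
    rw [incl_chart_symm x hu, ← mul_assoc, incl_inv_mul_incl, one_mul, sliceEquiv_apply]
    ext <;> simp only [shear, param, re_mk, imI_mk, imJ_mk, imIJ_mk]
    ring

/-! ### The differential of the inclusion and left-invariant extensions. -/

/-- The differential at `1` of the parametrization: `(a, b, c) ↦ (a, b, 0, c)`. -/
lemma hasFDerivAt_param_proj_one :
    HasFDerivAt (param α β) ((sliceEquiv α β : _ →L[ℝ] GenBicomplex α β).comp
      (ContinuousLinearMap.inl ℝ (EuclideanSpace ℝ (Fin 3)) ℝ))
      (proj (1 : GenBicomplex α β)) := by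
  set p := proj (1 : GenBicomplex α β)
  have hp : p 0 = 1 ∧ p 1 = 0 ∧ p 2 = 0 := ⟨rfl, rfl, rfl⟩
  have hc (k : Fin 3) : HasFDerivAt (fun u : EuclideanSpace ℝ (Fin 3) => u k)
      (EuclideanSpace.proj k : EuclideanSpace ℝ (Fin 3) →L[ℝ] ℝ) p :=
    (EuclideanSpace.proj k : EuclideanSpace ℝ (Fin 3) →L[ℝ] ℝ).hasFDerivAt
  have hinv : DifferentiableAt ℝ (fun u : EuclideanSpace ℝ (Fin 3) => (u 0)⁻¹) p :=
    (hc 0).differentiableAt.inv (by simp [hp.1])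
  have hf := (((hc 1).mul (hc 2)).mul hinv.hasFDerivAt).const_mul (-α)
  -- Every term of the product rule keeps a factor `u 1` or `u 2`, which vanishes at `p`; the value
  -- of the derivative of `(u 0)⁻¹` is therefore irrelevant.
  simp only [Pi.mul_apply, hp.2.1, hp.2.2, zero_smul, smul_zero, add_zero, mul_zero] at hf
  have hL := ((sliceEquiv α β : _ →L[ℝ] GenBicomplex α β).comp
      (ContinuousLinearMap.inl ℝ (EuclideanSpace ℝ (Fin 3)) ℝ)).hasFDerivAt (x := p)
  have h := hL.add (hf.smul_const (GenBicomplex.j : GenBicomplex α β))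
  refine (h.congr_fderiv ?_).congr_of_eventuallyEq (Filter.Eventually.of_forall fun u => ?_)
  · ext1 v
    simp
  · change param α β u = sliceEquiv α β (u, 0) + (-α * (u 1 * u 2 * (u 0)⁻¹)) • GenBicomplex.j
    ext <;> simp only [param, sliceEquiv_apply, GenBicomplex.j, re_mk, imI_mk, imJ_mk, imIJ_mk,
      re_add, imI_add, imJ_add, imIJ_add, re_smul, imI_smul, imJ_smul, imIJ_smul] <;> ring

lemma components_one (v : TangentSpace 𝓘(ℝ, EuclideanSpace ℝ (Fin 3)) (1 : MtI α β)) :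
    components 1 v = sliceEquiv α β ((v : EuclideanSpace ℝ (Fin 3)), 0) := by
  have hpt : chart (1 : MtI α β) 1 = proj (1 : GenBicomplex α β) := by
    change proj ((1⁻¹ : MtI α β) * 1).incl = _
    rw [inv_one, one_mul, incl_one]
  have hmem : proj (1 : GenBicomplex α β) ∈ (chart (1 : MtI α β)).target := by
    rw [← hpt]
    exact (chart 1).map_source (mem_chart_source _ 1)
  have h : HasMFDerivAt 𝓘(ℝ, EuclideanSpace ℝ (Fin 3)) 𝓘(ℝ, GenBicomplex α β)
      (incl : MtI α β → GenBicomplex α β) 1 ((sliceEquiv α β : _ →L[ℝ] GenBicomplex α β).comp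
      (ContinuousLinearMap.inl ℝ (EuclideanSpace ℝ (Fin 3)) ℝ)) := by
    refine ⟨isEmbedding_incl.continuous.continuousAt, HasFDerivAt.hasFDerivWithinAt ?_⟩
    change HasFDerivAt (fun u => ((chart (1 : MtI α β)).symm u).incl) _ (chart (1 : MtI α β) 1)
    rw [hpt]
    -- The inverse chart agrees with `param` only on the chart target, which is a neighbourhood of
    -- the base point.
    refine hasFDerivAt_param_proj_one.congr_of_eventuallyEq ?_
    filter_upwards [(chart (1 : MtI α β)).open_target.mem_nhds hmem] with u hu
    rw [incl_chart_symm 1 hu, incl_one, one_mul]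
  exact congrArg (fun L => L v) h.mfderiv

/-- Differentiate `incl ∘ (x * ·) = (x.incl * ·) ∘ incl` at the identity; the outer map on the right
is linear, so it is its own derivative. -/
lemma components_mulInvariantVectorField
    (v : GroupLieAlgebra 𝓘(ℝ, EuclideanSpace ℝ (Fin 3)) (MtI α β)) (x : MtI α β) :
    components x (mulInvariantVectorField v x) = x.incl * components 1 v := by
  have hincl (y : MtI α β) : MDifferentiableAt 𝓘(ℝ, EuclideanSpace ℝ (Fin 3))
      𝓘(ℝ, GenBicomplex α β) (incl : MtI α β → GenBicomplex α β) y :=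
    (contMDiff_incl y).mdifferentiableAt (by simp)
  have hmul : MDifferentiableAt 𝓘(ℝ, EuclideanSpace ℝ (Fin 3)) 𝓘(ℝ, EuclideanSpace ℝ (Fin 3))
      (fun y : MtI α β => x * y) 1 :=
    (contMDiff_mul_left (I := 𝓘(ℝ, EuclideanSpace ℝ (Fin 3))) (n := ∞)
      (a := x)).contMDiffAt.mdifferentiableAt (by simp)
  let L : GenBicomplex α β →L[ℝ] GenBicomplex α β :=
    LinearMap.toContinuousLinearMap (LinearMap.mulLeft ℝ x.incl)
  have h₁ := mfderiv_comp (1 : MtI α β) (hincl (x * 1)) hmul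
  have h₂ := mfderiv_comp (1 : MtI α β) L.differentiableAt.mdifferentiableAt (hincl 1)
  have h : components (x * 1) (mfderiv 𝓘(ℝ, EuclideanSpace ℝ (Fin 3))
      𝓘(ℝ, EuclideanSpace ℝ (Fin 3)) (fun y : MtI α β => x * y) 1 v) = x.incl * components 1 v := by
    have h₃ := congrArg (fun T => T v) (h₁.symm.trans h₂)
    rw [mfderiv_eq_fderiv, L.fderiv] at h₃
    exact h₃
  -- The chain rule lands in the fibre over `x * 1`. All fibres are definitionally the model space,
  -- so the base point can be rewritten after forgetting the dependence on it.
  have hx : (components (x * 1) : EuclideanSpace ℝ (Fin 3) →L[ℝ] GenBicomplex α β) =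
      components x :=
    let D : MtI α β → EuclideanSpace ℝ (Fin 3) →L[ℝ] GenBicomplex α β := fun y => components y
    congrArg D (mul_one x)
  exact (congrArg (fun T : EuclideanSpace ℝ (Fin 3) →L[ℝ] GenBicomplex α β =>
    T (mulInvariantVectorField v x)) hx).symm.trans h

end MtI

/-! ### Left-invariant vector fields on a general Lie group. -/

section LeftInvariant

variable {E H : Type*} [NormedAddCommGroup E] [NormedSpace ℝ E] [TopologicalSpace H]
  {I : ModelWithCorners ℝ E H} {G : Type*} [TopologicalSpace G] [ChartedSpace H G] [Group G] [LieGroup I ∞ G]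

/-- The field is a composite of smooth maps: `g ↦ (0_g, v)`, the identification of `TG × TG` with
`T(G × G)`, and the tangent map of multiplication. -/
lemma contMDiff_infty_mulInvariantVectorField (v : GroupLieAlgebra I G) :
    ContMDiff I I.tangent ∞
      (fun g : G => (⟨g, mulInvariantVectorField v g⟩ : TangentBundle I G)) := by
  have hmul := contMDiff_mul (G := G) I ∞
  have S₁ : ContMDiff I (I.tangent.prod I.tangent) ∞ (fun g : G =>
      ((⟨g, 0⟩, ⟨1, v⟩) : TangentBundle I G × TangentBundle I G)) :=
    (Bundle.contMDiff_zeroSection ℝ (TangentSpace I : G → Type _)).prodMk contMDiff_const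
  have S₂ : ContMDiff (I.tangent.prod I.tangent) (I.prod I).tangent ∞
      (equivTangentBundleProd I G I G).symm := contMDiff_equivTangentBundleProd_symm
  have S₃ : ContMDiff (I.prod I).tangent I.tangent ∞
      (tangentMap (I.prod I) I fun p : G × G => p.1 * p.2) :=
    hmul.contMDiff_tangentMap le_rfl
  have S := (S₃.comp S₂).comp S₁
  refine S.congr fun g => ?_
  have h := mfderiv_prod_eq_add_apply (I := I) (I' := I) (I'' := I) (p := ((g, 1) : G × G))
    (v := ((0, v) : E × E)) (hmul.mdifferentiableAt (by simp))
  have h' : mfderiv (I.prod I) I (fun p : G × G => p.1 * p.2) (g, 1) ((0, v) : E × E) =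
      mulInvariantVectorField v g := by
    refine h.trans ?_
    -- The partial derivative in the first factor is applied to `0`, so only `d(L_g) v` survives.
    have h₀ := map_zero (mfderiv I I (fun z : G => z * 1) g)
    let u : E := mulInvariantVectorField v g
    exact (congrArg (fun w : E => w + u) h₀).trans (zero_add u)
  have hg (w : E) (a b : G) (hab : a = b) :
      (⟨b, w⟩ : TangentBundle I G) = ⟨a, w⟩ := by rw [hab]
  refine (hg (mulInvariantVectorField v g) (g * 1) g (mul_one g)).trans ?_
  exact congrArg (fun w : E => (⟨g * 1, w⟩ : TangentBundle I G)) h'.symm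

variable (I G) in
/-- The linear map sending a tangent vector at the identity to its left-invariant extension. -/
def mulInvariantVectorFieldLinearMap : GroupLieAlgebra I G →ₗ[ℝ] ((g : G) → TangentSpace I g) where
  toFun v := mulInvariantVectorField v
  map_add' := mulInvariantVectorField_add
  map_smul' := mulInvariantVectorField_smul

/-- Invariance at `h = 1` gives `V g = d(L_g) (V 1)`. Conversely, extensions are invariant by the
chain rule for `L_{gh} = L_g ∘ L_h`. -/
lemma leftInvariantVectorFields_eq_range :
    leftInvariantVectorFields I G = LinearMap.range (mulInvariantVectorFieldLinearMap I G) := by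
  have hm (a b : G) : MDifferentiableAt I I (fun y : G => a * y) b :=
    (contMDiff_mul_left (I := I) (n := ∞) (a := a)).contMDiffAt.mdifferentiableAt (by simp)
  ext V
  constructor
  · rintro ⟨-, hV⟩
    refine ⟨V 1, funext fun g => ?_⟩
    exact (hV g 1).trans (congrArg (fun y => (V y : E)) (mul_one g))
  · rintro ⟨v, rfl⟩
    refine ⟨contMDiff_infty_mulInvariantVectorField v, fun g h => ?_⟩
    have hcomp : (fun y : G => g * h * y) = (fun y => g * y) ∘ fun y => h * y :=
      funext fun y => mul_assoc g h y
    change _ = mfderiv I I (fun y : G => g * h * y) 1 v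
    have h₁ := congrArg (fun T => T v) (mfderiv_comp (1 : G) (hm g (h * 1)) (hm h 1))
    have h₂ : (mfderiv I I (fun y : G => g * y) (h * 1) : E →L[ℝ] E) =
        mfderiv I I (fun y : G => g * y) h :=
      let D : G → E →L[ℝ] E := fun z => mfderiv I I (fun y : G => g * y) z
      congrArg D (mul_one h)
    rw [hcomp]
    exact (congrArg (fun T : E →L[ℝ] E => T (mulInvariantVectorField v h)) h₂).symm.trans h₁.symm

end LeftInvariant

/-! ### The tangent space at the identity. -/

namespace MtI

variable {α β : ℝ}

lemma components_one_injective : Function.Injective (components (1 : MtI α β)) := by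
  intro v w h
  rw [components_one, components_one] at h
  exact congrArg Prod.fst ((sliceEquiv α β).injective h)

lemma i_mul_j : (GenBicomplex.i * GenBicomplex.j : GenBicomplex α β) =
    GenBicomplex.mk 0 0 0 1 := by
  ext <;> simp [GenBicomplex.i, GenBicomplex.j]

lemma imJ_components_one
    (v : TangentSpace 𝓘(ℝ, EuclideanSpace ℝ (Fin 3)) (1 : MtI α β)) :
    (components 1 v).imJ = 0 := by
  rw [components_one]
  rfl

lemma eq_smul_add_of_imJ_eq_zero {x : GenBicomplex α β} (hx : x.imJ = 0) :
    x = x.re • 1 + x.imI • GenBicomplex.i + x.imIJ • (GenBicomplex.i * GenBicomplex.j) := by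
  rw [i_mul_j]
  ext <;> simp [GenBicomplex.i, hx]

lemma exists_components_one_eq {x : GenBicomplex α β} (hx : x.imJ = 0) :
    ∃ v : GroupLieAlgebra 𝓘(ℝ, EuclideanSpace ℝ (Fin 3)) (MtI α β), components 1 v = x := by
  refine ⟨(proj x : EuclideanSpace ℝ (Fin 3)), (components_one _).trans ?_⟩
  rw [sliceEquiv_apply]
  ext <;> simp [hx]

lemma range_components_one :
    LinearMap.range (components (1 : MtI α β)).toLinearMap =
      Submodule.span ℝ {(1 : GenBicomplex α β), GenBicomplex.i,
        GenBicomplex.i * GenBicomplex.j} := by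
  apply le_antisymm
  · rintro _ ⟨v, rfl⟩
    change components 1 v ∈ _
    rw [eq_smul_add_of_imJ_eq_zero (imJ_components_one v)]
    refine add_mem (add_mem ?_ ?_) ?_ <;>
      exact Submodule.smul_mem _ _ (Submodule.subset_span (by simp))
  · rw [Submodule.span_le]
    rintro x (rfl | rfl | rfl)
    · exact exists_components_one_eq imJ_one
    · exact exists_components_one_eq rfl
    · exact exists_components_one_eq (by rw [i_mul_j, imJ_mk])

end MtI
end

theorem mainTheorem4 (α β : ℝ) :
    Manifold.IsSmoothEmbedding 𝓘(ℝ, EuclideanSpace ℝ (Fin 3)) 𝓘(ℝ, GenBicomplex α β) ∞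
      (MtI.incl : MtI α β → GenBicomplex α β) ∧
    (LinearMap.range (MtI.components (1 : MtI α β)).toLinearMap =
        Submodule.span ℝ {(1 : GenBicomplex α β), GenBicomplex.i,
          GenBicomplex.i * GenBicomplex.j}) ∧
    (∀ v : GroupLieAlgebra 𝓘(ℝ, EuclideanSpace ℝ (Fin 3)) (MtI α β),
      (MtI.components 1 v).imJ = 0) ∧
    ∃ ξ₁ ξ₂ ξ₄ : GroupLieAlgebra 𝓘(ℝ, EuclideanSpace ℝ (Fin 3)) (MtI α β),
      MtI.components 1 ξ₁ = 1 ∧ MtI.components 1 ξ₂ = GenBicomplex.i ∧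
      MtI.components 1 ξ₄ = GenBicomplex.i * GenBicomplex.j ∧
      LinearIndependent ℝ ![ξ₁, ξ₂, ξ₄] ∧
      (⊤ : LieSubalgebra ℝ
          (GroupLieAlgebra 𝓘(ℝ, EuclideanSpace ℝ (Fin 3)) (MtI α β))).toSubmodule =
        Submodule.span ℝ {ξ₁, ξ₂, ξ₄} ∧
      (∀ x : MtI α β,
        MtI.components x (mulInvariantVectorField ξ₁ x) = x.incl ∧
        MtI.components x (mulInvariantVectorField ξ₁ x) =
          GenBicomplex.mk x.incl.re x.incl.imI x.incl.imJ x.incl.imIJ ∧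
        MtI.components x (mulInvariantVectorField ξ₂ x) = x.incl * GenBicomplex.i ∧
        MtI.components x (mulInvariantVectorField ξ₂ x) =
          GenBicomplex.mk (-α * x.incl.imI) x.incl.re (-α * x.incl.imIJ) x.incl.imJ ∧
        MtI.components x (mulInvariantVectorField ξ₄ x) = x.incl * (GenBicomplex.i * GenBicomplex.j) ∧
        MtI.components x (mulInvariantVectorField ξ₄ x) =
          GenBicomplex.mk (α * β * x.incl.imIJ) (-β * x.incl.imJ) (-α * x.incl.imI) x.incl.re) ∧
      leftInvariantVectorFields 𝓘(ℝ, EuclideanSpace ℝ (Fin 3)) (MtI α β) =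
        Submodule.span ℝ {mulInvariantVectorField ξ₁, mulInvariantVectorField ξ₂,
          mulInvariantVectorField ξ₄} := by
  obtain ⟨ξ₁, h₁⟩ := MtI.exists_components_one_eq (α := α) (β := β) (x := 1)
    GenBicomplex.imJ_one
  obtain ⟨ξ₂, h₂⟩ := MtI.exists_components_one_eq (α := α) (β := β) (x := GenBicomplex.i) rfl
  obtain ⟨ξ₄, h₄⟩ := MtI.exists_components_one_eq (α := α) (β := β)
    (x := GenBicomplex.i * GenBicomplex.j) (by rw [MtI.i_mul_j, GenBicomplex.imJ_mk])
  have hcomb (a b c : ℝ) : MtI.components 1 (a • ξ₁ + b • ξ₂ + c • ξ₄) =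
      a • (1 : GenBicomplex α β) + b • GenBicomplex.i +
        c • (GenBicomplex.i * GenBicomplex.j) := by
    rw [map_add, map_add, map_smul, map_smul, map_smul, h₁, h₂, h₄]
  have hspan : (⊤ : Submodule ℝ
      (GroupLieAlgebra 𝓘(ℝ, EuclideanSpace ℝ (Fin 3)) (MtI α β))) =
        Submodule.span ℝ {ξ₁, ξ₂, ξ₄} := by
    refine (eq_top_iff.2 fun v _ => ?_).symm
    -- Since the `j`-component vanishes, the other three components are the coefficients of `v`;
    -- injectivity of `components 1` transfers the identity from the algebra.
    have hv : v = (MtI.components 1 v).re • ξ₁ + (MtI.components 1 v).imI • ξ₂ +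
        (MtI.components 1 v).imIJ • ξ₄ := by
      apply MtI.components_one_injective
      rw [hcomb]
      exact MtI.eq_smul_add_of_imJ_eq_zero (MtI.imJ_components_one v)
    rw [hv]
    refine add_mem (add_mem ?_ ?_) ?_ <;>
      exact Submodule.smul_mem _ _ (Submodule.subset_span (by simp))
  refine ⟨MtI.isSmoothEmbedding_incl, MtI.range_components_one, MtI.imJ_components_one,
    ξ₁, ξ₂, ξ₄, h₁, h₂, h₄, ?_, hspan, fun x => ?_, ?_⟩
  · rw [Fintype.linearIndependent_iff]
    intro c hc
    have hc' : c 0 • ξ₁ + c 1 • ξ₂ + c 2 • ξ₄ = 0 := by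
      rw [← hc, Fin.sum_univ_three]
      rfl
    -- The coefficients are read off as the components along `1`, `i` and `ij`.
    have h := hcomb (c 0) (c 1) (c 2)
    rw [hc', map_zero, MtI.i_mul_j] at h
    have h0 := congrArg GenBicomplex.re h
    have h1 := congrArg GenBicomplex.imI h
    have h3 := congrArg GenBicomplex.imIJ h
    simp [GenBicomplex.i] at h0 h1 h3
    intro k
    fin_cases k
    exacts [h0.symm, h1.symm, h3.symm]
  · simp only [MtI.components_mulInvariantVectorField, h₁, h₂, h₄, mul_one, MtI.i_mul_j]
    refine ⟨trivial, ?_, trivial, ?_, trivial, ?_⟩ <;> ext <;> simp [GenBicomplex.i]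
  -- The invariant fields are the image of the whole Lie algebra under the linear extension map,
  -- hence the span of the images of the three generators.
  · rw [leftInvariantVectorFields_eq_range, LinearMap.range_eq_map, hspan, Submodule.map_span,
      Set.image_insert_eq, Set.image_insert_eq, Set.image_singleton]
    rfl
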